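/- Let $N=\mathbb Z^d$, $M=\mathrm{Hom}(N,\mathbb Z)$, and let $\Sigma$ be a complete fan of strictly convex rational polyhedral cones in $N_{\mathbb R}$ such that the associated toric scheme $X=X(\Sigma)$, obtained by gluing the affine schemes $U_\sigma=\mathrm{Spec}\,\mathbb Z[S_\sigma]$, $S_\sigma=M\cap\sigma^*$, $\sigma\in\Sigma$, along the open subschemes $U_{\sigma\cap\tau}$, is smooth over $\mathbb Z$. Let $D$ be a torus-invariant Cartier divisor on $X$ with support function $\psi_D:N_{\mathbb R}\to\mathbb R$, a continuous function given on each cone $\sigma\in\Sigma$ by a linear form $m_\sigma\in M$. Let $\Delta_D=\{v\in M_{\mathbb R}:\langle v,u\rangle\ge\psi_D(u)\ \text{for all }u\in N_{\mathbb R}\}$, and let $\mathcal O(D)$ be the associated line bundle, that is, the subsheaf of the sheaf of rational functions generated on $U_\sigma$ by $\chi^{m_\sigma}$. Endow $\mathcal O(D)$ with its canonical (Batyrev--Tschinkel/Maillot) metric $\|\cdot\|_\infty$, for which the generator $\chi^{m_\sigma}$ has norm $1$ at every point of $C_\sigma=\{x\in U_\sigma(\mathbb C):|\chi^m(x)|\le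 1\ \text{for all } m\in S_\sigma\}$ (the sets $C_\sigma$ cover $X(\mathbb C)$); write $\overline{\mathcal O(D)}_\infty$ for the resulting metrized line bundle, and $\|s\|_{\sup}=\sup_{x\in X(\mathbb C)}\|s\|_\infty(x)$. For every integer $l\ge 1$ let $$\widehat H^0(X,\overline{\mathcal O(lD)}_\infty)=\{s\in H^0(X,\mathcal O(lD)):\|s\|_{\sup}\le 1\}.$$ Then: 1. For every integer $l\ge1$, $$\widehat H^0(X,\overline{\mathcal O(lD)}_\infty)=\{\pm\chi^m : m\in l\Delta_D\cap M\}\cup\{0\}.$$ 2. For every integer $l\ge 1$, $\overline{\mathcal O(lD)}_\infty$ is not arithmetically big. (For a torus-invariant Cartier divisor $E$, $\overline{\mathcal O(E)}_\infty$ is called arithmetically big if $\mathcal O(E)_{\mathbb Q}$ is big on $X_{\mathbb Q}$ and there are an integer $k\ge1$ and a nonzero $s\in H^0(X,\mathcal O(kE))$ with $\|s\|_{\sup}<1$.) 3. The arithmetic volume vanishes: $$\widehat{\mathrm{vol}}(\overline{\mathcal O(D)}_\infty)=\limsup_{l\to\infty}\frac{\log\mathrm{Card}\,\widehat H^0(X,\overline{\mathcal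 O(lD)}_\infty)}{l^{d+1}/(d+1)!}=0.$$ -/

import Mathlib

open CategoryTheory CategoryTheory.Limits AlgebraicGeometry
open scoped Pointwise

noncomputable section

namespace Toric

/-- The inclusion of the lattice `ℤ^d` into the real vector space `ℝ^d`. -/
def toReal {d : ℕ} (m : Fin d → ℤ) : Fin d → ℝ := fun i => (m i : ℝ)

/-- `τ` is a face of the cone `σ`: there is `v` in the dual cone `σ^*` with
`τ = σ ∩ v^⊥`. -/
def IsFace {d : ℕ} (τ σ : PointedCone ℝ (Fin d → ℝ)) : Prop :=
  ∃ v : Fin d → ℝ, (∀ u ∈ σ, 0 ≤ v ⬝ᵥ u) ∧ ∀ u, u ∈ τ ↔ u ∈ σ ∧ v ⬝ᵥ u = 0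

/-- A fan in `N_ℝ`, where `N = ℤ^d`: a finite family of strictly convex rational polyhedral
cones, stable under taking faces, any two of which meet in a common face. The last field says that
the family is not empty (every strictly convex cone has `{0}` as a face). -/
structure Fan (d : ℕ) where
  cones : Set (PointedCone ℝ (Fin d → ℝ))
  finite : cones.Finite
  rational : ∀ σ ∈ cones, ∃ s : Finset (Fin d → ℤ), σ = PointedCone.hull ℝ (toReal '' (s : Set _))
  strict : ∀ σ ∈ cones, ∀ u ∈ σ, -u ∈ σ → u = 0
  face_mem : ∀ σ ∈ cones, ∀ τ, IsFace τ σ → τ ∈ cones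
  inf_isFace : ∀ σ ∈ cones, ∀ τ ∈ cones, IsFace (σ ⊓ τ) σ ∧ IsFace (σ ⊓ τ) τ
  zero_mem : ⊥ ∈ cones

/-- The fan is complete: its support is the whole of `N_ℝ`. -/
def Fan.IsComplete {d : ℕ} (F : Fan d) : Prop := ∀ u : Fin d → ℝ, ∃ σ ∈ F.cones, u ∈ σ

/-- The semigroup `S_σ = M ∩ σ^*`, where `M = ℤ^d` is the dual lattice of `N`. -/
def dualMonoid {d : ℕ} (σ : PointedCone ℝ (Fin d → ℝ)) : AddSubmonoid (Fin d → ℤ) where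
  carrier := {m | ∀ u ∈ σ, 0 ≤ toReal m ⬝ᵥ u}
  zero_mem' := by intro u _; simp [toReal, dotProduct]
  add_mem' := by
    intro a b ha hb u hu
    have h : toReal (a + b) = toReal a + toReal b := by ext i; simp [toReal]
    rw [h, add_dotProduct]
    exact add_nonneg (ha u hu) (hb u hu)

lemma toReal_add {d : ℕ} (a b : Fin d → ℤ) : toReal (a + b) = toReal a + toReal b := by
  ext i; simp [toReal]

lemma toReal_neg {d : ℕ} (a : Fin d → ℤ) : toReal (-a) = -toReal a := by
  ext i; simp [toReal]

lemma toReal_nsmul {d : ℕ} (k : ℕ) (a : Fin d → ℤ) : toReal (k • a) = (k : ℝ) • toReal a := by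
  ext i; simp [toReal]

lemma toReal_dot {d : ℕ} (a b : Fin d → ℤ) : toReal a ⬝ᵥ toReal b = ((a ⬝ᵥ b : ℤ) : ℝ) := by
  simp [toReal, dotProduct]

lemma dualMonoid_anti {d : ℕ} {σ τ : PointedCone ℝ (Fin d → ℝ)} (h : τ ≤ σ) :
    dualMonoid σ ≤ dualMonoid τ := fun _ hm u hu => hm u (h hu)

/-- A real linear form which is nonnegative on finitely many lattice vectors can be replaced
by an integral one with the same zeros among these vectors. -/
lemma exists_integral_form {d : ℕ} (s : Finset (Fin d → ℤ)) (v : Fin d → ℝ)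
    (hv : ∀ n ∈ s, 0 ≤ v ⬝ᵥ toReal n) :
    ∃ m : Fin d → ℤ, ∀ n ∈ s, 0 ≤ m ⬝ᵥ n ∧ (m ⬝ᵥ n = 0 ↔ v ⬝ᵥ toReal n = 0) := by
  classical
  let W : Submodule ℚ ℝ := Submodule.span ℚ (Set.range v)
  have : Module.Finite ℚ W := Module.Finite.span_of_finite ℚ (Set.finite_range v)
  let b := Module.finBasis ℚ W
  let r := Module.finrank ℚ W
  let w : Fin r → ℝ := fun j => (b j : ℝ)
  have hw : LinearIndependent ℚ w :=
    b.linearIndependent.map' W.subtype (Submodule.ker_subtype W)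
  let vW : Fin d → W := fun i => ⟨v i, Submodule.subset_span ⟨i, rfl⟩⟩
  let q : Fin d → Fin r → ℚ := fun i j => b.repr (vW i) j
  have hvq : ∀ i, v i = ∑ j, (q i j : ℝ) * w j := by
    intro i
    have h1 := congrArg (W.subtype) (b.sum_repr (vW i))
    simp only [map_sum, map_smul] at h1
    simpa [vW, q, w, Rat.smul_def] using h1.symm
  let L : (Fin d → ℤ) → Fin r → ℚ := fun n j => ∑ i, q i j * n i
  have hvL : ∀ n, v ⬝ᵥ toReal n = ∑ j, (L n j : ℝ) * w j := by
    intro n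
    simp only [dotProduct, hvq, toReal, L, Finset.sum_mul, Rat.cast_sum, Rat.cast_mul,
      Rat.cast_intCast]
    rw [Finset.sum_comm]
    refine Finset.sum_congr rfl fun j _ => Finset.sum_congr rfl fun i _ => by ring
  have hzero : ∀ n, v ⬝ᵥ toReal n = 0 → ∀ j, L n j = 0 := by
    intro n hn
    rw [hvL] at hn
    exact Fintype.linearIndependent_iff.mp hw (L n) (by simpa [Rat.smul_def] using hn)
  let U : Set (Fin r → ℝ) := {x | ∀ n ∈ s, 0 < v ⬝ᵥ toReal n → 0 < ∑ j, (L n j : ℝ) * x j}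
  have hU : IsOpen U := by
    have : U = ⋂ n ∈ s, {x | 0 < v ⬝ᵥ toReal n → 0 < ∑ j, (L n j : ℝ) * x j} := by
      ext x; simp [U]
    rw [this]
    refine isOpen_biInter_finset fun n _ => ?_
    by_cases h : 0 < v ⬝ᵥ toReal n
    · simp only [h, true_imp_iff]
      exact isOpen_lt continuous_const (by fun_prop)
    · simp [h]
  have hwU : w ∈ U := fun n _ h => by rwa [hvL] at h
  have hdense : DenseRange (fun (y : Fin r → ℚ) (j : Fin r) => ((y j : ℚ) : ℝ)) :=
    DenseRange.piMap fun _ => Rat.denseRange_cast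
  obtain ⟨y, hy⟩ := hdense.exists_mem_open hU ⟨w, hwU⟩
  let p : Fin d → ℚ := fun i => ∑ j, q i j * y j
  have hp : ∀ n : Fin d → ℤ, ∑ i, p i * (n i : ℚ) = ∑ j, L n j * y j := by
    intro n
    simp only [p, L, Finset.sum_mul]
    rw [Finset.sum_comm]
    refine Finset.sum_congr rfl fun j _ => Finset.sum_congr rfl fun i _ => by ring
  let N : ℕ := ∏ i, (p i).den
  have hN : 0 < N := Finset.prod_pos fun i _ => (p i).den_pos
  have hint : ∀ i, ∃ z : ℤ, (z : ℚ) = N * p i := by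
    intro i
    obtain ⟨c, hc⟩ := Finset.dvd_prod_of_mem (fun i => (p i).den) (Finset.mem_univ i)
    refine ⟨c * (p i).num, ?_⟩
    have h2 : (N : ℚ) = (p i).den * c := by exact_mod_cast hc
    rw [h2]
    push_cast
    have h3 := Rat.mul_den_eq_num (p i)
    rw [← h3]; ring
  choose m hm using hint
  have key : ∀ n : Fin d → ℤ, ((m ⬝ᵥ n : ℤ) : ℚ) = N * ∑ j, L n j * y j := by
    intro n
    rw [← hp]
    simp [dotProduct, hm, Finset.mul_sum, mul_assoc]
  refine ⟨m, fun n hn => ?_⟩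
  have hNq : (0 : ℚ) < N := by exact_mod_cast hN
  rcases (hv n hn).eq_or_lt with h0 | hpos
  · have : (m ⬝ᵥ n : ℤ) = 0 := by
      have h := key n
      simp only [hzero n h0.symm, zero_mul, Finset.sum_const_zero, mul_zero] at h
      exact_mod_cast h
    exact ⟨this.ge, fun _ => h0.symm, fun _ => this⟩
  · have h1 : (0 : ℚ) < ∑ j, L n j * y j := by
      have h3 : (0 : ℝ) < ∑ j, (L n j : ℝ) * (y j : ℝ) := hy n hn hpos
      exact_mod_cast h3
    have h2 : 0 < (m ⬝ᵥ n : ℤ) := by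
      have : (0 : ℚ) < ((m ⬝ᵥ n : ℤ) : ℚ) := by rw [key]; positivity
      exact_mod_cast this
    exact ⟨h2.le, fun h => absurd h h2.ne', fun h => absurd h hpos.ne'⟩

lemma mem_hull_iff {d : ℕ} (s : Finset (Fin d → ℤ)) (u : Fin d → ℝ) :
    u ∈ PointedCone.hull ℝ (toReal '' (s : Set (Fin d → ℤ))) ↔
      ∃ c : (Fin d → ℤ) → ℝ, (∀ n, 0 ≤ c n) ∧ u = ∑ n ∈ s, c n • toReal n := by
  constructor
  · intro hu
    induction hu using Submodule.span_induction with
    | mem x hx =>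
      classical
      obtain ⟨n, hn, rfl⟩ := hx
      refine ⟨fun k => if k = n then 1 else 0, fun k => by dsimp only; split_ifs <;> norm_num, ?_⟩
      simp [ite_smul, Finset.mem_coe.mp hn]
    | zero => exact ⟨0, by simp, by simp⟩
    | add x y _ _ hx hy =>
      obtain ⟨a, ha, rfl⟩ := hx
      obtain ⟨b, hb, rfl⟩ := hy
      exact ⟨a + b, fun n => add_nonneg (ha n) (hb n), by simp [add_smul, Finset.sum_add_distrib]⟩
    | smul t x _ hx =>
      obtain ⟨a, ha, rfl⟩ := hx
      refine ⟨fun n => (t : ℝ) * a n, fun n => mul_nonneg t.2 (ha n), ?_⟩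
      rw [Finset.smul_sum]
      refine Finset.sum_congr rfl fun n _ => ?_
      rw [mul_smul]; rfl
  · rintro ⟨c, hc, rfl⟩
    refine Submodule.sum_mem _ fun n hn => ?_
    exact PointedCone.smul_mem _ (hc n) (Submodule.subset_span ⟨n, hn, rfl⟩)

lemma mem_dualMonoid_hull {d : ℕ} (s : Finset (Fin d → ℤ)) (m : Fin d → ℤ) :
    m ∈ dualMonoid (PointedCone.hull ℝ (toReal '' (s : Set (Fin d → ℤ)))) ↔
      ∀ n ∈ s, 0 ≤ m ⬝ᵥ n := by
  constructor
  · intro h n hn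
    have := h _ (Submodule.subset_span ⟨n, hn, rfl⟩)
    rw [toReal_dot] at this
    exact_mod_cast this
  · intro h u hu
    obtain ⟨c, hc, rfl⟩ := (mem_hull_iff s u).mp hu
    rw [dotProduct_sum]
    refine Finset.sum_nonneg fun n hn => ?_
    rw [dotProduct_smul, toReal_dot]
    exact mul_nonneg (hc n) (by exact_mod_cast h n hn)

/-- The data of a face of a rational cone in terms of lattice points of the dual cone. -/
lemma exists_face_vector {d : ℕ} {σ τ : PointedCone ℝ (Fin d → ℝ)}
    (hσ : ∃ s : Finset (Fin d → ℤ), σ = PointedCone.hull ℝ (toReal '' (s : Set _)))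
    (h : IsFace τ σ) :
    ∃ m ∈ dualMonoid σ, ∀ u, u ∈ τ ↔ u ∈ σ ∧ toReal m ⬝ᵥ u = 0 := by
  obtain ⟨s, rfl⟩ := hσ
  obtain ⟨v, hv, hτ⟩ := h
  have hvs : ∀ n ∈ s, 0 ≤ v ⬝ᵥ toReal n := fun n hn =>
    hv _ (Submodule.subset_span ⟨n, hn, rfl⟩)
  obtain ⟨m, hm⟩ := exists_integral_form s v hvs
  refine ⟨m, (mem_dualMonoid_hull s m).mpr fun n hn => (hm n hn).1, fun u => ?_⟩
  rw [hτ]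
  refine and_congr_right fun hu => ?_
  obtain ⟨c, hc, rfl⟩ := (mem_hull_iff s u).mp hu
  simp only [dotProduct_sum, dotProduct_smul, toReal_dot, smul_eq_mul]
  rw [Finset.sum_eq_zero_iff_of_nonneg fun n hn => mul_nonneg (hc n) (hvs n hn),
    Finset.sum_eq_zero_iff_of_nonneg fun n hn => mul_nonneg (hc n) (by exact_mod_cast (hm n hn).1)]
  refine forall₂_congr fun n hn => ?_
  simp only [mul_eq_zero, Int.cast_eq_zero, (hm n hn).2]

lemma exists_add_nsmul_mem {d : ℕ} {σ τ : PointedCone ℝ (Fin d → ℝ)}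
    (hσ : ∃ s : Finset (Fin d → ℤ), σ = PointedCone.hull ℝ (toReal '' (s : Set _)))
    {m : Fin d → ℤ} (hm : m ∈ dualMonoid σ)
    (hτ : ∀ u, u ∈ τ ↔ u ∈ σ ∧ toReal m ⬝ᵥ u = 0) {w : Fin d → ℤ} (hw : w ∈ dualMonoid τ) :
    ∃ k : ℕ, w + k • m ∈ dualMonoid σ := by
  obtain ⟨s, rfl⟩ := hσ
  rw [mem_dualMonoid_hull] at hm
  refine ⟨∑ n ∈ s, (w ⬝ᵥ n).natAbs, (mem_dualMonoid_hull s _).mpr fun n hn => ?_⟩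
  rw [add_dotProduct, smul_dotProduct]
  have hle : (w ⬝ᵥ n).natAbs ≤ ∑ n ∈ s, (w ⬝ᵥ n).natAbs :=
    Finset.single_le_sum (f := fun n => (w ⬝ᵥ n).natAbs) (fun _ _ => Nat.zero_le _) hn
  rcases (hm n hn).eq_or_lt with h0 | hpos
  · have : toReal n ∈ τ := (hτ _).mpr ⟨Submodule.subset_span ⟨n, hn, rfl⟩, by
      rw [toReal_dot, ← h0]; simp⟩
    have h1 := hw _ this
    rw [toReal_dot] at h1
    have h2 : 0 ≤ w ⬝ᵥ n := by exact_mod_cast h1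
    rw [← h0]; simpa using h2
  · rw [nsmul_eq_mul]
    have : ((w ⬝ᵥ n).natAbs : ℤ) ≤ (∑ n ∈ s, (w ⬝ᵥ n).natAbs : ℕ) := by exact_mod_cast hle
    have h3 : -(w ⬝ᵥ n) ≤ ((w ⬝ᵥ n).natAbs : ℤ) := by omega
    nlinarith

section Algebra

variable {d : ℕ} (R : Type) [CommRing R]

/-- The coordinate ring `R[S_σ]` of the affine toric variety `U_σ`. -/
abbrev coordRing (σ : PointedCone ℝ (Fin d → ℝ)) : Type := AddMonoidAlgebra R (dualMonoid σ)

/-- The inclusion `R[S_σ] → R[S_τ]` for `τ ⊆ σ`. -/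
def restr {σ τ : PointedCone ℝ (Fin d → ℝ)} (h : τ ≤ σ) : coordRing R σ →+* coordRing R τ :=
  AddMonoidAlgebra.mapDomainRingHom R (AddSubmonoid.inclusion (dualMonoid_anti h))

lemma restr_injective {σ τ : PointedCone ℝ (Fin d → ℝ)} (h : τ ≤ σ) :
    Function.Injective (restr R h) :=
  AddMonoidAlgebra.mapDomain_injective (AddSubmonoid.inclusion_injective _)

lemma restr_single {σ τ : PointedCone ℝ (Fin d → ℝ)} (h : τ ≤ σ) (m : dualMonoid σ) (r : R) :
    restr R h (AddMonoidAlgebra.single m r) =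
      AddMonoidAlgebra.single (⟨m, dualMonoid_anti h m.2⟩ : dualMonoid τ) r :=
  AddMonoidAlgebra.mapDomain_single

lemma restr_comp {σ τ ρ : PointedCone ℝ (Fin d → ℝ)} (h : τ ≤ σ) (h' : ρ ≤ τ) :
    (restr R h').comp (restr R h) = restr R (h'.trans h) := by
  rw [restr, restr, ← AddMonoidAlgebra.mapDomainRingHom_comp]; rfl

lemma restr_refl (σ : PointedCone ℝ (Fin d → ℝ)) : restr R (le_refl σ) = RingHom.id _ :=
  AddMonoidAlgebra.mapDomainRingHom_id

lemma neg_mem_dualMonoid {σ τ : PointedCone ℝ (Fin d → ℝ)} {m : Fin d → ℤ}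
    (hτ : ∀ u, u ∈ τ ↔ u ∈ σ ∧ toReal m ⬝ᵥ u = 0) : -m ∈ dualMonoid τ := by
  intro u hu
  rw [toReal_neg, neg_dotProduct, ((hτ u).mp hu).2, neg_zero]

lemma isUnit_restr_single {σ τ : PointedCone ℝ (Fin d → ℝ)} (h : τ ≤ σ)
    (m : dualMonoid σ) (hτ : ∀ u, u ∈ τ ↔ u ∈ σ ∧ toReal (m : Fin d → ℤ) ⬝ᵥ u = 0) :
    IsUnit (restr R h (AddMonoidAlgebra.single m 1)) := by
  refine IsUnit.of_mul_eq_one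
    (AddMonoidAlgebra.single (⟨-m, neg_mem_dualMonoid hτ⟩ : dualMonoid τ) 1) ?_
  rw [restr_single, AddMonoidAlgebra.single_mul_single, AddMonoidAlgebra.one_def]
  congr 1
  · ext1; simp
  · simp

/-- If `τ = σ ∩ m^⊥` is a face of `σ`, then `R[S_τ]` is the localization of `R[S_σ]` at `χ^m`. -/
lemma isLocalization_restr {σ τ : PointedCone ℝ (Fin d → ℝ)} (h : τ ≤ σ)
    (hσ : ∃ s : Finset (Fin d → ℤ), σ = PointedCone.hull ℝ (toReal '' (s : Set _)))
    (m : dualMonoid σ) (hτ : ∀ u, u ∈ τ ↔ u ∈ σ ∧ toReal (m : Fin d → ℤ) ⬝ᵥ u = 0) :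
    letI := (restr R h).toAlgebra
    IsLocalization.Away (AddMonoidAlgebra.single m 1 : coordRing R σ) (coordRing R τ) := by
  let _ := (restr R h).toAlgebra
  have halg : algebraMap (coordRing R σ) (coordRing R τ) = restr R h := rfl
  refine (isLocalization_iff _ _).mpr ⟨?_, ?_, ?_⟩
  · rintro ⟨_, k, rfl⟩
    rw [halg, map_pow]
    exact (isUnit_restr_single R h m hτ).pow k
  · intro z
    suffices H : ∃ k : ℕ, ∃ x : coordRing R σ,
        z * restr R h (AddMonoidAlgebra.single m 1) ^ k = restr R h x by
      obtain ⟨k, x, hx⟩ := H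
      refine ⟨(x, ⟨_, k, rfl⟩), ?_⟩
      rw [halg]
      simp only [map_pow]
      exact hx
    induction z using AddMonoidAlgebra.induction_linear with
    | zero => exact ⟨0, 0, by simp⟩
    | add f g hf hg =>
      obtain ⟨k, x, hx⟩ := hf
      obtain ⟨l, y, hy⟩ := hg
      refine ⟨k + l, x * AddMonoidAlgebra.single m 1 ^ l + y * AddMonoidAlgebra.single m 1 ^ k, ?_⟩
      rw [map_add, map_mul, map_mul, ← hx, ← hy, map_pow, map_pow]
      ring
    | single w r =>
      obtain ⟨k, hk⟩ := exists_add_nsmul_mem hσ m.2 hτ w.2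
      refine ⟨k, AddMonoidAlgebra.single ⟨_, hk⟩ r, ?_⟩
      rw [← map_pow, AddMonoidAlgebra.single_pow, restr_single, restr_single,
        AddMonoidAlgebra.single_mul_single]
      congr 1
      simp
  · intro x y hxy
    exact ⟨1, by rw [restr_injective R h hxy]⟩

lemma isOpenImmersion_restr {σ τ : PointedCone ℝ (Fin d → ℝ)} (h : τ ≤ σ)
    (hσ : ∃ s : Finset (Fin d → ℤ), σ = PointedCone.hull ℝ (toReal '' (s : Set _)))
    (hf : IsFace τ σ) : IsOpenImmersion (Spec.map (CommRingCat.ofHom (restr R h))) := by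
  obtain ⟨m, hm, hτ⟩ := exists_face_vector hσ hf
  let _ := (restr R h).toAlgebra
  have := isLocalization_restr R h hσ ⟨m, hm⟩ hτ
  exact IsOpenImmersion.of_isLocalization (S := coordRing R τ)
    (AddMonoidAlgebra.single ⟨m, hm⟩ 1 : coordRing R σ)

/-- A prime of `R[S_σ]` lies in `U_τ`, for a face `τ = σ ∩ m^⊥`, as soon as it does not contain
`χ^m`. -/
lemma exists_comap_restr {σ τ : PointedCone ℝ (Fin d → ℝ)} (h : τ ≤ σ)
    (hσ : ∃ s : Finset (Fin d → ℤ), σ = PointedCone.hull ℝ (toReal '' (s : Set _)))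
    (m : dualMonoid σ) (hτ : ∀ u, u ∈ τ ↔ u ∈ σ ∧ toReal (m : Fin d → ℤ) ⬝ᵥ u = 0)
    (p : PrimeSpectrum (coordRing R σ)) :
    (∃ q, PrimeSpectrum.comap (restr R h) q = p) ↔
      (AddMonoidAlgebra.single m 1 : coordRing R σ) ∉ p.asIdeal := by
  let _ := (restr R h).toAlgebra
  have := isLocalization_restr R h hσ m hτ
  have := PrimeSpectrum.localization_away_comap_range (coordRing R τ)
    (AddMonoidAlgebra.single m 1 : coordRing R σ)
  exact Set.ext_iff.mp this p

end Algebra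

namespace Fan

variable {d : ℕ} (F : Fan d) (R : Type) [CommRing R]

lemma isFace_of_le {σ τ : PointedCone ℝ (Fin d → ℝ)} (hσ : σ ∈ F.cones) (hτ : τ ∈ F.cones)
    (h : τ ≤ σ) : IsFace τ σ := by
  have := (F.inf_isFace τ hτ σ hσ).2
  rwa [inf_eq_left.mpr h] at this

lemma inf_mem {σ τ : PointedCone ℝ (Fin d → ℝ)} (hσ : σ ∈ F.cones) (hτ : τ ∈ F.cones) :
    σ ⊓ τ ∈ F.cones := F.face_mem σ hσ _ (F.inf_isFace σ hσ τ hτ).1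

/-- The diagram of the affine toric varieties `U_σ = Spec R[S_σ]`, for `σ ∈ F`, with the
canonical open immersions `U_τ → U_σ` for `τ ⊆ σ`. -/
def diagram : F.cones ⥤ Scheme.{0} where
  obj σ := Spec (CommRingCat.of (coordRing R σ.1))
  map {τ σ} f := Spec.map (CommRingCat.ofHom (restr R (leOfHom f)))
  map_id σ := by
    rw [restr_refl]; exact Spec.map_id _
  map_comp {ρ τ σ} f g := by
    rw [← Spec.map_comp, ← CommRingCat.ofHom_comp, restr_comp]

instance {τ σ : F.cones} (f : τ ⟶ σ) : IsOpenImmersion ((F.diagram R).map f) :=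
  isOpenImmersion_restr R (leOfHom f) (F.rational _ σ.2) (F.isFace_of_le σ.2 τ.2 (leOfHom f))

instance : (F.diagram R ⋙ Scheme.forget).IsLocallyDirected where
  cond {i j k} fi fj xi xj hx := by
    have hx' : PrimeSpectrum.comap (restr R (leOfHom fi)) xi =
      PrimeSpectrum.comap (restr R (leOfHom fj)) xj := hx
    have hk := F.rational _ k.2
    obtain ⟨a, ha, hi⟩ := exists_face_vector hk (F.isFace_of_le k.2 i.2 (leOfHom fi))
    obtain ⟨b, hb, hj⟩ := exists_face_vector hk (F.isFace_of_le k.2 j.2 (leOfHom fj))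
    have h1 := (exists_comap_restr R (leOfHom fi) hk ⟨a, ha⟩ hi _).mp ⟨xi, rfl⟩
    have h2 := (exists_comap_restr R (leOfHom fj) hk ⟨b, hb⟩ hj _).mp ⟨xj, rfl⟩
    rw [← hx'] at h2
    let l : F.cones := ⟨i.1 ⊓ j.1, F.inf_mem i.2 j.2⟩
    have hli : l ≤ i := inf_le_left (a := i.1) (b := j.1)
    have hlj : l ≤ j := inf_le_right (a := i.1) (b := j.1)
    have hl : ∀ u, u ∈ l.1 ↔ u ∈ k.1 ∧ toReal (a + b) ⬝ᵥ u = 0 := by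
      intro u
      have h3 : u ∈ l.1 ↔ u ∈ i.1 ∧ u ∈ j.1 := Submodule.mem_inf
      rw [h3, hi, hj, toReal_add, add_dotProduct]
      constructor
      · rintro ⟨⟨h, h'⟩, -, h''⟩
        exact ⟨h, by rw [h', h'', add_zero]⟩
      · rintro ⟨h, h'⟩
        have := ha u h
        have := hb u h
        exact ⟨⟨h, by linarith⟩, h, by linarith⟩
    obtain ⟨q, hq⟩ := (exists_comap_restr R (hli.trans (leOfHom fi)) hk
      ⟨a + b, add_mem ha hb⟩ hl (PrimeSpectrum.comap (restr R (leOfHom fi)) xi)).mpr (by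
        intro hmem
        have h4 : (AddMonoidAlgebra.single (⟨a + b, add_mem ha hb⟩ : dualMonoid k.1) 1 :
            coordRing R k.1) = AddMonoidAlgebra.single (⟨a, ha⟩ : dualMonoid k.1) 1 *
              AddMonoidAlgebra.single (⟨b, hb⟩ : dualMonoid k.1) 1 := by
          rw [AddMonoidAlgebra.single_mul_single, mul_one]; rfl
        rw [h4] at hmem
        exact ((PrimeSpectrum.isPrime _).mem_or_mem hmem).elim h1 h2)
    refine ⟨l, homOfLE hli, homOfLE hlj, q, ?_, ?_⟩
    · apply ((F.diagram R).map fi).isOpenEmbedding.injective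
      change PrimeSpectrum.comap _ (PrimeSpectrum.comap _ q) = PrimeSpectrum.comap _ xi
      rw [← PrimeSpectrum.comap_comp_apply]
      exact (congrArg (fun f => PrimeSpectrum.comap f q)
        (restr_comp R (leOfHom fi) hli)).trans hq
    · apply ((F.diagram R).map fj).isOpenEmbedding.injective
      change PrimeSpectrum.comap _ (PrimeSpectrum.comap _ q) = PrimeSpectrum.comap _ xj
      rw [← PrimeSpectrum.comap_comp_apply]
      exact (congrArg (fun f => PrimeSpectrum.comap f q)
        (restr_comp R (leOfHom fj) hlj)).trans (hq.trans hx')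

/-- The toric scheme `X(F)` over `R`: the gluing of the affine schemes `U_σ`, `σ ∈ F`, along the
open subschemes `U_{σ ∩ τ}`. -/
def toricScheme : Scheme.{0} := colimit (F.diagram R)

/-- The open immersion `U_σ → X(F)`. -/
def ι (σ : F.cones) : Spec (CommRingCat.of (coordRing R σ.1)) ⟶ F.toricScheme R :=
  colimit.ι (F.diagram R) σ

instance (σ : F.cones) : IsOpenImmersion (F.ι R σ) :=
  inferInstanceAs (IsOpenImmersion (colimit.ι (F.diagram R) σ))

lemma map_ι {σ τ : F.cones} (h : τ ≤ σ) :
    Spec.map (CommRingCat.ofHom (restr R h)) ≫ F.ι R σ = F.ι R τ :=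
  colimit.w (F.diagram R) (homOfLE h)

/-- The structure morphism `X(F) → Spec R`. -/
def structureMorphism : F.toricScheme R ⟶ Spec (CommRingCat.of R) :=
  colimit.desc (F.diagram R)
    { pt := Spec (CommRingCat.of R)
      ι :=
        { app := fun σ => Spec.map (CommRingCat.ofHom (algebraMap R (coordRing R σ.1)))
          naturality := by
            intro τ σ f
            change Spec.map _ ≫ Spec.map _ = Spec.map _ ≫ 𝟙 _
            rw [Category.comp_id, ← Spec.map_comp, ← CommRingCat.ofHom_comp]
            congr 2
            ext r
            · simp [restr]
              } }

section Integral

variable [IsDomain R]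

instance (σ : PointedCone ℝ (Fin d → ℝ)) : IsDomain (coordRing R σ) := by
  have hinj : Function.Injective
      (AddMonoidAlgebra.mapDomainRingHom R (dualMonoid σ).subtype) :=
    AddMonoidAlgebra.mapDomain_injective Subtype.val_injective
  exact hinj.isDomain _

/-- The zero cone `{0}` of the fan; the corresponding open subscheme is the torus `Spec R[M]`. -/
def zeroCone : F.cones := ⟨⊥, F.zero_mem⟩

lemma zeroCone_le (σ : F.cones) : F.zeroCone ≤ σ := bot_le (a := σ.1)

instance : IrreducibleSpace (F.toricScheme R) := by
  have key : ∀ A : Set (F.toricScheme R), IsOpen A → A.Nonempty →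
      ((F.ι R F.zeroCone) ⁻¹' A).Nonempty := by
    rintro A hA ⟨x, hx⟩
    obtain ⟨σ, y, rfl⟩ := Scheme.IsLocallyDirected.ι_jointly_surjective (F.diagram R) x
    let j := (F.diagram R).map (homOfLE (F.zeroCone_le σ))
    obtain ⟨z, hz, w, rfl⟩ := nonempty_preirreducible_inter
      (hA.preimage (F.ι R σ).continuous) j.isOpenEmbedding.isOpen_range
      ⟨y, hx⟩ (Set.range_nonempty (ι := Spec (CommRingCat.of (coordRing R _))) j)
    refine ⟨w, ?_⟩
    have h1 : F.ι R F.zeroCone w = F.ι R σ (j w) := by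
      rw [← F.map_ι R (F.zeroCone_le σ)]
      rfl
    change F.ι R F.zeroCone w ∈ A
    exact h1 ▸ hz
  refine @IrreducibleSpace.mk _ _ ⟨?_⟩ ?_
  · intro A B hA hB hA' hB'
    simp only [Set.univ_inter] at hA' hB' ⊢
    obtain ⟨z, hz, hz'⟩ := nonempty_preirreducible_inter
      (hA.preimage (F.ι R F.zeroCone).continuous) (hB.preimage (F.ι R F.zeroCone).continuous)
      (key A hA hA') (key B hB hB')
    exact ⟨_, hz, hz'⟩
  · exact ⟨F.ι R F.zeroCone
      (Nonempty.some (inferInstanceAs (Nonempty (Spec (CommRingCat.of (coordRing R _))))))⟩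

instance : IsIntegral (F.toricScheme R) := by
  have : ∀ i, AlgebraicGeometry.IsReduced
      ((Scheme.IsLocallyDirected.openCover (F.diagram R)).X i) := fun i =>
    inferInstanceAs (AlgebraicGeometry.IsReduced (Spec (CommRingCat.of (coordRing R _))))
  have : AlgebraicGeometry.IsReduced (F.toricScheme R) :=
    IsReduced.of_openCover _ (Scheme.IsLocallyDirected.openCover (F.diagram R))
  exact isIntegral_of_irreducibleSpace_of_isReduced _

/-- The field of rational functions on the toric scheme. -/
abbrev RatFun : Type := (F.toricScheme R).functionField

lemma genericPoint_mem (U : (F.toricScheme R).Opens) [h : Nonempty U] :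
    genericPoint (F.toricScheme R) ∈ U :=
  ((genericPoint_spec (F.toricScheme R)).mem_open_set_iff U.isOpen).mpr (by simpa using h)

instance : Nonempty (⊤ : (F.toricScheme R).Opens) := ⟨⟨genericPoint _, trivial⟩⟩

lemma genericPoint_mem_inf (U V : (F.toricScheme R).Opens) [Nonempty U] [Nonempty V] :
    genericPoint (F.toricScheme R) ∈ U ⊓ V :=
  ⟨F.genericPoint_mem R U, F.genericPoint_mem R V⟩

/-- The open subscheme `U_σ` of the toric scheme. -/
abbrev chart (σ : F.cones) : (F.toricScheme R).Opens := (F.ι R σ) ''ᵁ ⊤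

instance (σ : F.cones) : Nonempty (F.chart R σ) :=
  ⟨⟨F.ι R σ (Nonempty.some (inferInstanceAs (Nonempty (Spec (CommRingCat.of (coordRing R _)))))),
    ⟨_, trivial, rfl⟩⟩⟩

/-- The rational function defined by a regular function on a nonempty open subset. -/
abbrev toRatFun (U : (F.toricScheme R).Opens) (hU : genericPoint (F.toricScheme R) ∈ U) :
    Γ(F.toricScheme R, U) ⟶ (F.toricScheme R).functionField :=
  (F.toricScheme R).presheaf.germ U _ hU

/-- The rational function defined by an element of `R[S_σ]`, a regular function on `U_σ`. -/
def chartToRatFun (σ : F.cones) : coordRing R σ.1 →+* F.RatFun R :=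
  ((Scheme.ΓSpecIso (CommRingCat.of (coordRing R σ.1))).inv ≫ ((F.ι R σ).appIso ⊤).inv ≫
    F.toRatFun R (F.chart R σ) (F.genericPoint_mem R _)).hom

/-- The field of rational functions is an algebra over `R` through the structure morphism. -/
instance : Algebra R (F.RatFun R) :=
  RingHom.toAlgebra ((Scheme.ΓSpecIso (CommRingCat.of R)).inv ≫
    (F.structureMorphism R).appTop ≫ F.toRatFun R ⊤ trivial).hom

/-- The character `χ^m` of the torus, as a rational function. -/
def character (m : Fin d → ℤ) : F.RatFun R :=
  F.chartToRatFun R F.zeroCone (AddMonoidAlgebra.single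
    (⟨m, by
      intro u hu
      have h : u = 0 := hu
      simp [h]⟩ : dualMonoid F.zeroCone.1) 1)

end Integral

end Fan

/-- A torus invariant Cartier divisor `D` on the toric scheme of `F`, given by its support
function `ψ_D`: a continuous function on `N_ℝ` whose restriction to each cone `σ` of the fan is an
integral linear form `m_σ ∈ M`. The multiplicity of `D` along the divisor of a ray with primitive
generator `u` is `-ψ_D(u)`. -/
structure ToricDivisor {d : ℕ} (F : Fan d) where
  ψ : (Fin d → ℝ) → ℝ
  continuous : Continuous ψ
  linear : ∀ σ ∈ F.cones, ∃ m : Fin d → ℤ, ∀ u ∈ σ, ψ u = toReal m ⬝ᵥ u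

namespace ToricDivisor

variable {d : ℕ} {F : Fan d} (D : ToricDivisor F)

/-- The multiples `lD`. -/
instance : SMul ℕ (ToricDivisor F) where
  smul l D :=
    { ψ := fun u => l * D.ψ u
      continuous := continuous_const.mul D.continuous
      linear := by
        intro σ hσ
        obtain ⟨m, hm⟩ := D.linear σ hσ
        refine ⟨l • m, fun u hu => ?_⟩
        rw [hm u hu, toReal_nsmul, smul_dotProduct, smul_eq_mul] }

/-- A linear form `m_σ` which defines `ψ_D` on the cone `σ`. It is unique up to `σ^⊥ ∩ M`. -/
def localForm (σ : F.cones) : Fin d → ℤ := (D.linear σ.1 σ.2).choose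

/-- The polytope `Δ_D = {v ∈ M_ℝ : ⟨v, u⟩ ≥ ψ_D(u) for all u ∈ N_ℝ}`. -/
def polytope : Set (Fin d → ℝ) := {v | ∀ u, D.ψ u ≤ v ⬝ᵥ u}

section Bundle

variable (R : Type) [CommRing R] [IsDomain R]

/-- The sections over a nonempty open subset `U` of the invertible sheaf `O(D)`, the subsheaf of
the constant sheaf of rational functions whose restriction to `U_σ` is generated by `χ^{m_σ}`. -/
def sections (U : (F.toricScheme R).Opens) [Nonempty U] : Submodule R (F.RatFun R) where
  carrier := {f | ∀ σ : F.cones, ∃ g : Γ(F.toricScheme R, U ⊓ F.chart R σ),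
    F.toRatFun R _ (F.genericPoint_mem_inf R U (F.chart R σ)) g =
      F.character R (-D.localForm σ) * f}
  zero_mem' := fun σ => ⟨0, by simp⟩
  add_mem' := by
    intro a b ha hb σ
    obtain ⟨x, hx⟩ := ha σ
    obtain ⟨y, hy⟩ := hb σ
    exact ⟨x + y, by rw [map_add, hx, hy, mul_add]⟩
  smul_mem' := by
    intro r a ha σ
    obtain ⟨x, hx⟩ := ha σ
    let c : Γ(F.toricScheme R, ⊤) := (F.structureMorphism R).appTop.hom
      ((Scheme.ΓSpecIso (CommRingCat.of R)).inv.hom r)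
    let i : U ⊓ F.chart R σ ⟶ ⊤ := homOfLE le_top
    refine ⟨(F.toricScheme R).presheaf.map i.op c * x, ?_⟩
    have h1 : F.toRatFun R (U ⊓ F.chart R σ)
        (F.genericPoint_mem_inf R U (F.chart R σ))
        ((F.toricScheme R).presheaf.map i.op c) = algebraMap R (F.RatFun R) r :=
      (F.toricScheme R).presheaf.germ_res_apply i _ _ c
    rw [map_mul, hx, h1, Algebra.smul_def]
    ring

/-- The module `H^0(X, O(D))` of global sections. -/
def globalSections : Submodule R (F.RatFun R) := D.sections R ⊤

end Bundle

/-- A line bundle `O(D)` on the toric variety over a field `k` is big if its volume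
`limsup h^0(X_k, O(lD)) / (l^d / d!)` is positive. -/
def IsBig (k : Type) [Field k] : Prop :=
  0 < Filter.limsup (fun l : ℕ => (Module.finrank k ((l • D).globalSections k) : ENNReal) /
    ((l : ENNReal) ^ d / (d.factorial : ENNReal))) Filter.atTop

/-- The canonical norm `‖s‖_∞(x)` of a global section `s` of `O(D)` at a complex point `x`.
The set of complex points is covered by the compact subsets `C_σ = {x ∈ U_σ(ℂ) : |χ^m(x)| ≤ 1 for
all m ∈ S_σ}`, and the canonical metric is the one for which the generator `χ^{m_σ}` of `O(D)` on
`U_σ` has norm one on `C_σ`. So for `x ∈ C_σ`, given by the ring homomorphism `φ : ℤ[S_σ] → ℂ`,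
and `s = g χ^{m_σ}` with `g ∈ ℤ[S_σ]`, the norm is `|g(x)| = |φ(g)|`. This value does not depend on
the `σ` with `x ∈ C_σ`; the supremum below is their common value. -/
def canonicalNorm (s : F.RatFun ℤ) (x : Spec (CommRingCat.of ℂ) ⟶ F.toricScheme ℤ) : ENNReal :=
  ⨆ (σ : F.cones) (φ : coordRing ℤ σ.1 →+* ℂ) (g : coordRing ℤ σ.1)
    (_ : Spec.map (CommRingCat.ofHom φ) ≫ F.ι ℤ σ = x)
    (_ : ∀ m : dualMonoid σ.1, ‖φ (AddMonoidAlgebra.single m 1)‖ ≤ 1)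
    (_ : F.chartToRatFun ℤ σ g = F.character ℤ (-D.localForm σ) * s), ‖φ g‖ₑ

/-- The sup norm of a global section for the canonical metric. -/
def supNorm (s : F.RatFun ℤ) : ENNReal :=
  ⨆ x : Spec (CommRingCat.of ℂ) ⟶ F.toricScheme ℤ, D.canonicalNorm s x

/-- The small sections of `O(D)` with its canonical metric: the global sections on the toric
scheme over `ℤ` with sup norm at most one. -/
def smallSections : Set (F.RatFun ℤ) :=
  {s | s ∈ D.globalSections ℤ ∧ D.supNorm s ≤ 1}

/-- `O(D)` with its canonical metric is arithmetically big: `O(D)` is big on the generic fibre,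
the toric variety over `ℚ`, and some positive multiple has a nonzero global section over `ℤ` with
sup norm less than one. The canonical metric of `O(lD)` is the `l`-th power of that of `O(D)`. -/
def IsArithmeticallyBig : Prop :=
  D.IsBig ℚ ∧ ∃ l : ℕ, l ≠ 0 ∧ ∃ s ∈ (l • D).globalSections ℤ, s ≠ 0 ∧ (l • D).supNorm s < 1

/-- The arithmetic volume of `O(D)` with its canonical metric,
`limsup (log Card {small sections of lD}) / (l^{d+1} / (d+1)!)`. -/
def arithmeticVolume : EReal :=
  Filter.limsup (fun l : ℕ => ENNReal.log (((l • D).smallSections.encard : ℕ∞) : ENNReal) /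
    (((l : ℝ) ^ (d + 1) / ((d + 1).factorial : ℝ) : ℝ) : EReal)) Filter.atTop

end ToricDivisor

end Toric

end

/-! The argument is Parseval's identity on the compact torus combined with integrality of
coefficients. On the open torus `Spec ℤ[M]`, the chart of the zero cone, a section of `O(D)` becomes
a Laurent polynomial with integer coefficients, up to multiplication by one character. There `C_0`
contains the compact torus, since characters have absolute value one on it. A section of sup norm at
most one is therefore a Laurent polynomial bounded by one on the compact torus. Its coefficients
have squares summing to at most one (`sum_norm_sq_le_one`), so, being integers, at most one is
nonzero and that one is `±1` (`eq_zero_or_single_of_norm_le_one`).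

Thus a nonzero small section is `±χ^m`. By completeness of the fan, `χ^m` is a global section
exactly when `m` lies in the polytope, and in that case `|χ^{m - m_σ}| ≤ 1` on each `C_σ`; this
gives `smallSections_eq`. A character has norm one at the identity of the torus, which excludes
nonzero sections of norm less than one. Finally the polytope is bounded, so `lD` has at most `K l^d`
small sections, and `log (K l^d)` is negligible against `l^(d+1)`. -/

namespace Toric

/-! ### Regular functions on the charts inside the function field -/

/-- Restricting a function from the image of an open immersion to a smaller such image. -/
lemma appIso_inv_map {X Y Z : Scheme.{0}} (j : Z ⟶ Y) (f : Y ⟶ X) (g : Z ⟶ X)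
    [IsOpenImmersion f] [IsOpenImmersion g] (h : j ≫ f = g) (e : g ''ᵁ ⊤ ≤ f ''ᵁ ⊤) :
    (f.appIso ⊤).inv ≫ X.presheaf.map (homOfLE e).op = j.appTop ≫ (g.appIso ⊤).inv := by
  rw [Iso.inv_comp_eq, ← Category.assoc, Iso.eq_comp_inv, Scheme.Hom.appIso_hom',
    Scheme.Hom.appIso_hom', Scheme.Hom.map_appLE]
  subst h
  rw [Scheme.Hom.appTop, Scheme.Hom.app_eq_appLE]
  exact (Scheme.Hom.appLE_comp_appLE _ _ _ _ _ _ _).symm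

namespace Fan

variable {d : ℕ} (F : Fan d) (R : Type) [CommRing R]

lemma chart_mono {σ τ : F.cones} (h : τ ≤ σ) : F.chart R τ ≤ F.chart R σ := by
  rintro _ ⟨y, -, rfl⟩
  refine ⟨Spec.map (CommRingCat.ofHom (restr R h)) y, trivial, ?_⟩
  rw [← F.map_ι R h]
  rfl

variable [IsDomain R]

/-- The rational functions defined on `U_τ` and `U_σ`, `τ ⊆ σ`, are compatible. -/
lemma chartToRatFun_restr {σ τ : F.cones} (h : τ ≤ σ) (x : coordRing R σ.1) :
    F.chartToRatFun R τ (restr R h x) = F.chartToRatFun R σ x := by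
  have e := F.chart_mono R h
  have h1 := appIso_inv_map _ _ _ (F.map_ι R h) e
  have h2 : (Scheme.ΓSpecIso (CommRingCat.of (coordRing R σ.1))).inv ≫
      ((F.ι R σ).appIso ⊤).inv ≫ F.toRatFun R (F.chart R σ) (F.genericPoint_mem R _) =
      CommRingCat.ofHom (restr R h) ≫ (Scheme.ΓSpecIso (CommRingCat.of (coordRing R τ.1))).inv ≫
      ((F.ι R τ).appIso ⊤).inv ≫ F.toRatFun R (F.chart R τ) (F.genericPoint_mem R _) := by
    have h3 : F.toRatFun R (F.chart R σ) (F.genericPoint_mem R _) =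
        (F.toricScheme R).presheaf.map (homOfLE e).op ≫
          F.toRatFun R (F.chart R τ) (F.genericPoint_mem R _) :=
      ((F.toricScheme R).presheaf.germ_res (homOfLE e) _ (F.genericPoint_mem R _)).symm
    rw [h3, reassoc_of% h1, ← Scheme.ΓSpecIso_inv_naturality_assoc]
  have h3 := congrArg (fun f => f.hom x) h2
  exact h3.symm

/-- A section over an open subset of an integral scheme is determined by its germ at the generic
point. Identities between rational functions can therefore be read off as identities between
elements of `R[S_σ]`. -/
lemma chartToRatFun_injective (σ : F.cones) : Function.Injective (F.chartToRatFun R σ) := by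
  have h1 : Function.Injective (F.toRatFun R (F.chart R σ) (F.genericPoint_mem R _)) :=
    germ_injective_of_isIntegral _ _ _
  intro x y hxy
  have h2 := h1 hxy
  have h3 : ∀ {A B : CommRingCat} (i : A ≅ B), Function.Injective i.hom := fun i =>
    (ConcreteCategory.bijective_of_isIso i.hom).1
  exact h3 (Scheme.ΓSpecIso (CommRingCat.of (coordRing R σ.1))).symm
    (h3 ((F.ι R σ).appIso ⊤).symm h2)

/-- The rational functions which are regular on `U_σ`. -/
lemma exists_toRatFun_chart_iff (σ : F.cones) (f : F.RatFun R) :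
    (∃ g : Γ(F.toricScheme R, ⊤ ⊓ F.chart R σ), F.toRatFun R _
      (F.genericPoint_mem_inf R ⊤ (F.chart R σ)) g = f) ↔ f ∈ (F.chartToRatFun R σ).range := by
  -- The open set `⊤ ⊓ U_σ` equals `U_σ` only propositionally and occurs in the type of `g`;
  -- generalizing it to a variable `U` allows substitution.
  have key : ∀ (U : (F.toricScheme R).Opens) (hU : genericPoint (F.toricScheme R) ∈ U),
      U = F.chart R σ → ((∃ g : Γ(F.toricScheme R, U), F.toRatFun R _ hU g = f) ↔
        f ∈ (F.chartToRatFun R σ).range) := by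
    rintro U hU rfl
    have h3 : ∀ {A B : CommRingCat} (i : A ≅ B), Function.Surjective i.hom := fun i =>
      (ConcreteCategory.bijective_of_isIso i.hom).2
    constructor
    · rintro ⟨g, rfl⟩
      obtain ⟨y, rfl⟩ := h3 ((F.ι R σ).appIso ⊤).symm g
      obtain ⟨x, rfl⟩ := h3 (Scheme.ΓSpecIso (CommRingCat.of (coordRing R σ.1))).symm y
      exact ⟨x, rfl⟩
    · rintro ⟨x, rfl⟩
      exact ⟨((Scheme.ΓSpecIso (CommRingCat.of (coordRing R σ.1))).inv ≫
        ((F.ι R σ).appIso ⊤).inv).hom x, rfl⟩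
  exact key _ _ (top_inf_eq _)

lemma mem_dualMonoid_zeroCone (m : Fin d → ℤ) : m ∈ dualMonoid F.zeroCone.1 := by
  intro u hu
  have h : u = 0 := hu
  simp [h]

lemma character_eq (m : Fin d → ℤ) : F.character R m =
    F.chartToRatFun R F.zeroCone
      (AddMonoidAlgebra.single ⟨m, F.mem_dualMonoid_zeroCone m⟩ 1) := rfl

lemma chartToRatFun_single (σ : F.cones) (m : dualMonoid σ.1) :
    F.chartToRatFun R σ (AddMonoidAlgebra.single m 1) = F.character R m := by
  rw [← F.chartToRatFun_restr R (F.zeroCone_le σ), restr_single, character_eq]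

lemma character_add (m n : Fin d → ℤ) :
    F.character R (m + n) = F.character R m * F.character R n := by
  simp only [character_eq, ← map_mul, AddMonoidAlgebra.single_mul_single, mul_one]
  rfl

lemma character_zero : F.character R 0 = 1 := by
  rw [character_eq, ← map_one (F.chartToRatFun R F.zeroCone), AddMonoidAlgebra.one_def]
  rfl

/-- A character is regular on `U_σ` only if its exponent lies in `S_σ`. -/
lemma mem_dualMonoid_of_chartToRatFun_eq {σ : F.cones} {m : Fin d → ℤ} {x : coordRing R σ.1}
    (h : F.chartToRatFun R σ x = F.character R m) : m ∈ dualMonoid σ.1 := by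
  rw [← F.chartToRatFun_restr R (F.zeroCone_le σ), character_eq] at h
  have h1 := F.chartToRatFun_injective R _ h
  by_contra hm
  have h2 := congrArg (fun f : coordRing R F.zeroCone.1 =>
    f.coeff ⟨m, F.mem_dualMonoid_zeroCone m⟩) h1
  -- Restriction to the torus keeps exponents, so nothing outside `S_σ` can occur in the image of
  -- `x`, whereas `χ^m` has coefficient one at `m`.
  have h3 : (restr R (F.zeroCone_le σ) x).coeff ⟨m, F.mem_dualMonoid_zeroCone m⟩ = 0 := by
    refine Finsupp.mapDomain_of_notMem_range _ _ ?_
    rintro ⟨y, hy⟩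
    have h4 : (y : Fin d → ℤ) = m := congrArg Subtype.val hy
    exact hm (h4 ▸ y.2)
  simp [h3] at h2

end Fan

/-! ### Integral Laurent polynomials on the compact torus -/

/-- Parseval's inequality for a trigonometric polynomial bounded by one. -/
lemma sum_norm_sq_le_one {ι κ : Type*} [Fintype κ] (s : Finset ι) (e : ι → κ → ℤ)
    (he : Function.Injective e) (a : ι → ℂ)
    (h : ∀ t : UnitAddTorus κ, ‖∑ i ∈ s, a i * UnitAddTorus.mFourier (e i) t‖ ≤ 1) :
    ∑ i ∈ s, ‖a i‖ ^ 2 ≤ 1 := by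
  let μ : MeasureTheory.Measure (UnitAddTorus κ) :=
    MeasureTheory.Measure.pi fun _ => AddCircle.haarAddCircle
  let L := ContinuousMap.toLp (E := ℂ) 2 μ ℂ
  let f : C(UnitAddTorus κ, ℂ) := ∑ i ∈ s, a i • UnitAddTorus.mFourier (e i)
  have hf : ‖f‖ ≤ 1 := by
    refine (ContinuousMap.norm_le _ zero_le_one).mpr fun t => ?_
    simpa [f] using h t
  have hL : ‖L f‖ ≤ 1 := by
    refine (L.le_opNorm f).trans (mul_le_one₀ ?_ (norm_nonneg _) hf)
    -- The Haar measure has total mass one, so the `L²` norm is at most the sup norm.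
    refine (ContinuousMap.toLp_norm_le _).trans ?_
    simp [μ, MeasureTheory.measureUnivNNReal]
  have horth : Orthonormal ℂ fun i => L (UnitAddTorus.mFourier (e i)) :=
    UnitAddTorus.orthonormal_mFourier.comp e he
  have hsum : L f = ∑ i ∈ s, a i • L (UnitAddTorus.mFourier (e i)) := by
    simp only [f, map_sum, map_smul]
  have h1 := horth.inner_sum a a s
  rw [← hsum, inner_self_eq_norm_sq_to_K] at h1
  have h2 : ‖L f‖ ^ 2 = ∑ i ∈ s, ‖a i‖ ^ 2 := by
    have : ∀ i, (starRingEnd ℂ) (a i) * a i = ((‖a i‖ ^ 2 : ℝ) : ℂ) := fun i => by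
      rw [Complex.conj_mul']; push_cast; rfl
    simp only [this] at h1
    have h3 : ((‖L f‖ ^ 2 : ℝ) : ℂ) = ((∑ i ∈ s, ‖a i‖ ^ 2 : ℝ) : ℂ) := by
      push_cast
      simpa using h1
    exact_mod_cast h3
  rw [← h2]
  exact pow_le_one₀ (norm_nonneg _) hL

/-- Integers whose squares sum to at most one: at most one of them is not zero, and it is `±1`. -/
lemma int_sum_sq_le_one {ι : Type*} (s : Finset ι) (a : ι → ℤ) (h : ∑ i ∈ s, a i ^ 2 ≤ 1) :
    (∀ i ∈ s, a i = 0) ∨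
      ∃ i ∈ s, (a i = 1 ∨ a i = -1) ∧ ∀ j ∈ s, j ≠ i → a j = 0 := by
  classical
  by_cases h0 : ∀ i ∈ s, a i = 0
  · exact Or.inl h0
  push Not at h0
  obtain ⟨i, hi, hai⟩ := h0
  refine Or.inr ⟨i, hi, ?_⟩
  -- A nonzero integer already uses up the whole bound, leaving zero for the remaining squares.
  have h1 : 1 ≤ a i ^ 2 := by have := sq_pos_of_ne_zero hai; omega
  have h2 := Finset.add_sum_erase s (fun i => a i ^ 2) hi
  have h3 : 0 ≤ ∑ j ∈ s.erase i, a j ^ 2 := Finset.sum_nonneg fun _ _ => sq_nonneg _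
  have h4 : ∑ j ∈ s.erase i, a j ^ 2 = 0 := by omega
  refine ⟨sq_eq_one_iff.mp (by omega), fun j hj hji => ?_⟩
  have := (Finset.sum_eq_zero_iff_of_nonneg fun _ _ => sq_nonneg _).mp h4 j
    (Finset.mem_erase.mpr ⟨hji, hj⟩)
  exact pow_eq_zero_iff two_ne_zero |>.mp this

/-- The point of the compact torus with argument `t`, as a complex point of the open torus. -/
noncomputable def torusPoint {d : ℕ} (σ : PointedCone ℝ (Fin d → ℝ))
    (t : UnitAddTorus (Fin d)) : coordRing ℤ σ →+* ℂ :=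
  (AddMonoidAlgebra.lift ℤ ℂ (dualMonoid σ)
    { toFun := fun m => UnitAddTorus.mFourier (m.toAdd : Fin d → ℤ) t
      map_one' := by simp [UnitAddTorus.mFourier_zero]
      map_mul' := fun m n => by
        rw [toAdd_mul, AddSubmonoid.coe_add, UnitAddTorus.mFourier_add] }).toRingHom

lemma torusPoint_apply {d : ℕ} (σ : PointedCone ℝ (Fin d → ℝ)) (t : UnitAddTorus (Fin d))
    (g : coordRing ℤ σ) : torusPoint σ t g =
      ∑ m ∈ g.coeff.support, (g.coeff m : ℂ) * UnitAddTorus.mFourier (m : Fin d → ℤ) t := by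
  change AddMonoidAlgebra.lift ℤ ℂ (dualMonoid σ) _ g = _
  rw [AddMonoidAlgebra.lift_apply, Finsupp.sum]
  simp only [zsmul_eq_mul]
  rfl

lemma torusPoint_single {d : ℕ} (σ : PointedCone ℝ (Fin d → ℝ)) (t : UnitAddTorus (Fin d))
    (m : dualMonoid σ) : torusPoint σ t (AddMonoidAlgebra.single m 1) =
      UnitAddTorus.mFourier (m : Fin d → ℤ) t := by
  change AddMonoidAlgebra.lift ℤ ℂ (dualMonoid σ) _ _ = _
  rw [AddMonoidAlgebra.lift_single, one_smul]
  rfl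

lemma norm_mFourier_apply {d : ℕ} (m : Fin d → ℤ) (t : UnitAddTorus (Fin d)) :
    ‖UnitAddTorus.mFourier m t‖ = 1 := by
  simp only [UnitAddTorus.mFourier, fourier_apply, ContinuousMap.coe_mk, norm_prod, Circle.norm_coe,
    Finset.prod_const_one]

/-- A Laurent polynomial with integral coefficients which is bounded by one on the compact torus
is zero or a monomial up to sign. -/
lemma eq_zero_or_single_of_norm_le_one {d : ℕ} {σ : PointedCone ℝ (Fin d → ℝ)} (g : coordRing ℤ σ)
    (h : ∀ t, ‖torusPoint σ t g‖ ≤ 1) :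
    g = 0 ∨ ∃ m, g = AddMonoidAlgebra.single m 1 ∨ g = -AddMonoidAlgebra.single m 1 := by
  have h1 := sum_norm_sq_le_one g.coeff.support (fun m : dualMonoid σ => (m : Fin d → ℤ))
    Subtype.val_injective (fun m => (g.coeff m : ℂ)) fun t => by
      rw [← torusPoint_apply]; exact h t
  have h2 : ∑ m ∈ g.coeff.support, g.coeff m ^ 2 ≤ 1 := by
    have : ∀ z : ℤ, ‖(z : ℂ)‖ ^ 2 = ((z ^ 2 : ℤ) : ℝ) := fun z => by
      rw [Complex.norm_intCast, sq_abs]; push_cast; rfl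
    simp only [this] at h1
    exact_mod_cast h1
  rcases int_sum_sq_le_one _ _ h2 with h0 | ⟨m, -, hm, hne⟩
  · left
    ext m
    by_cases hm : m ∈ g.coeff.support
    · exact h0 m hm
    · exact Finsupp.notMem_support_iff.mp hm
  · right
    have h3 : g = AddMonoidAlgebra.single m (g.coeff m) := by
      ext n
      rw [AddMonoidAlgebra.coeff_single]
      by_cases hn : n = m
      · rw [hn, Finsupp.single_eq_same]
      · rw [Finsupp.single_eq_of_ne hn]
        by_cases hs : n ∈ g.coeff.support
        · exact hne n hs hn
        · exact Finsupp.notMem_support_iff.mp hs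
    refine ⟨m, ?_⟩
    rcases hm with hm | hm
    · left; rw [h3, hm]
    · right; rw [h3, hm, ← AddMonoidAlgebra.single_neg]

/-! ### Global sections of `O(D)` and characters in the polytope -/

namespace ToricDivisor

variable {d : ℕ} {F : Fan d} (D : ToricDivisor F)

lemma localForm_spec (σ : F.cones) {u : Fin d → ℝ} (hu : u ∈ σ.1) :
    D.ψ u = toReal (D.localForm σ) ⬝ᵥ u :=
  (D.linear σ.1 σ.2).choose_spec u hu

/-- Translates the sheaf condition on each `U_σ` into algebra: after division by `χ^{m_σ}`, the
section must come from `R[S_σ]`. -/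
lemma mem_globalSections_iff (R : Type) [CommRing R] [IsDomain R] (s : F.RatFun R) :
    s ∈ D.globalSections R ↔
      ∀ σ : F.cones, F.character R (-D.localForm σ) * s ∈ (F.chartToRatFun R σ).range :=
  forall_congr' fun σ => F.exists_toRatFun_chart_iff R σ _

lemma sub_localForm_mem (σ : F.cones) {m : Fin d → ℤ} (hm : toReal m ∈ D.polytope) :
    -D.localForm σ + m ∈ dualMonoid σ.1 := by
  intro u hu
  have h := hm u
  rw [D.localForm_spec σ hu] at h
  rw [toReal_add, toReal_neg, add_dotProduct, neg_dotProduct]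
  linarith

lemma character_mem_globalSections (R : Type) [CommRing R] [IsDomain R] {m : Fin d → ℤ}
    (hm : toReal m ∈ D.polytope) : F.character R m ∈ D.globalSections R := by
  refine (D.mem_globalSections_iff R _).mpr fun σ => ?_
  rw [← F.character_add, ← F.chartToRatFun_single R σ ⟨_, D.sub_localForm_mem σ hm⟩]
  exact ⟨_, rfl⟩

/-- Regularity of `χ^{m - m_σ}` on `U_σ` says `⟨m, u⟩ ≥ ψ_D(u)` for `u ∈ σ`. Completeness of the fan
is what makes these inequalities reach every `u`. -/
lemma mem_polytope_of_character_mem (hF : F.IsComplete) (R : Type) [CommRing R] [IsDomain R]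
    {m : Fin d → ℤ} (hm : F.character R m ∈ D.globalSections R) : toReal m ∈ D.polytope := by
  intro u
  obtain ⟨σ, hσ, hu⟩ := hF u
  obtain ⟨g, hg⟩ := (D.mem_globalSections_iff R _).mp hm ⟨σ, hσ⟩
  rw [← F.character_add] at hg
  have h := F.mem_dualMonoid_of_chartToRatFun_eq R hg u hu
  rw [toReal_add, toReal_neg, add_dotProduct, neg_dotProduct] at h
  rw [D.localForm_spec ⟨σ, hσ⟩ hu]
  linarith

/-! ### Sup norms and small sections -/

lemma enorm_le_supNorm {σ : F.cones} (φ : coordRing ℤ σ.1 →+* ℂ) (g : coordRing ℤ σ.1)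
    {s : F.RatFun ℤ} (hφ : ∀ m : dualMonoid σ.1, ‖φ (AddMonoidAlgebra.single m 1)‖ ≤ 1)
    (hg : F.chartToRatFun ℤ σ g = F.character ℤ (-D.localForm σ) * s) :
    ‖φ g‖ₑ ≤ D.supNorm s := by
  refine le_trans ?_ (le_iSup _ (Spec.map (CommRingCat.ofHom φ) ≫ F.ι ℤ σ))
  exact le_iSup_of_le σ <| le_iSup_of_le φ <| le_iSup_of_le g <| le_iSup_of_le rfl <|
    le_iSup_of_le hφ <| le_iSup_of_le hg le_rfl

/-- Together with `enorm_le_supNorm`, this makes the sup norm a supremum over triples `(σ, φ, g)`,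
so the agreement of the local norms on overlaps of the sets `C_σ` is never needed. -/
lemma supNorm_le_of_forall {s : F.RatFun ℤ} {C : ENNReal}
    (h : ∀ (σ : F.cones) (φ : coordRing ℤ σ.1 →+* ℂ) (g : coordRing ℤ σ.1),
      (∀ m : dualMonoid σ.1, ‖φ (AddMonoidAlgebra.single m 1)‖ ≤ 1) →
      F.chartToRatFun ℤ σ g = F.character ℤ (-D.localForm σ) * s → ‖φ g‖ₑ ≤ C) :
    D.supNorm s ≤ C :=
  iSup_le fun _ => iSup_le fun σ => iSup_le fun φ => iSup_le fun g => iSup_le fun _ =>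
    iSup_le fun hφ => iSup_le fun hg => h σ φ g hφ hg

lemma supNorm_zero : D.supNorm 0 = 0 := by
  refine le_antisymm (D.supNorm_le_of_forall fun σ φ g _ hg => ?_) zero_le
  rw [mul_zero, map_eq_zero_iff _ (F.chartToRatFun_injective ℤ σ)] at hg
  simp [hg]

lemma supNorm_neg (s : F.RatFun ℤ) : D.supNorm (-s) = D.supNorm s := by
  have key : ∀ s : F.RatFun ℤ, D.supNorm (-s) ≤ D.supNorm s := fun s => by
    refine D.supNorm_le_of_forall fun σ φ g hφ hg => ?_
    have := D.enorm_le_supNorm φ (-g) (s := s) hφ (by rw [map_neg, hg, mul_neg, neg_neg])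
    rwa [map_neg, enorm_neg] at this
  exact le_antisymm (key s) (by simpa using key (-s))

/-- For `m` in the polytope, `m - m_σ` lies in `S_σ`, and `|χ^{m - m_σ}| ≤ 1` is one of the
inequalities defining `C_σ`. -/
lemma supNorm_character_le {m : Fin d → ℤ} (hm : toReal m ∈ D.polytope) :
    D.supNorm (F.character ℤ m) ≤ 1 := by
  refine D.supNorm_le_of_forall fun σ φ g hφ hg => ?_
  rw [← F.character_add, ← F.chartToRatFun_single ℤ σ ⟨_, D.sub_localForm_mem σ hm⟩] at hg
  rw [F.chartToRatFun_injective ℤ σ hg, ← ofReal_norm]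
  exact ENNReal.ofReal_le_one.mpr (hφ _)

/-- Evaluation at the identity of the torus, `t = 0`, gives exactly one. No condition on `m` is
needed, since the torus chart sees every exponent. -/
lemma one_le_supNorm_character (m : Fin d → ℤ) : 1 ≤ D.supNorm (F.character ℤ m) := by
  have h := D.enorm_le_supNorm (σ := F.zeroCone) (s := F.character ℤ m)
    (torusPoint F.zeroCone.1 0)
    (AddMonoidAlgebra.single ⟨_, F.mem_dualMonoid_zeroCone (-D.localForm F.zeroCone + m)⟩ 1)
    (fun m => by rw [torusPoint_single, norm_mFourier_apply])
    (by rw [F.chartToRatFun_single, F.character_add])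
  rwa [torusPoint_single, ← ofReal_norm, norm_mFourier_apply, ENNReal.ofReal_one] at h

/-- The small sections of `O(D)` are zero and the characters in `Δ_D`, up to sign. -/
lemma smallSections_eq (hF : F.IsComplete) :
    D.smallSections = {s | ∃ m : Fin d → ℤ, toReal m ∈ D.polytope ∧
      (s = F.character ℤ m ∨ s = -F.character ℤ m)} ∪ {0} := by
  ext s
  constructor
  · rintro ⟨hs, hnorm⟩
    obtain ⟨g, hg⟩ := (D.mem_globalSections_iff ℤ s).mp hs F.zeroCone
    -- The form chosen on the zero cone is arbitrary, as every `m ∈ M` vanishes there. It only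
    -- shifts the exponents of `g`, so it is carried along and absorbed into the final character.
    have hs' : s = F.character ℤ (D.localForm F.zeroCone) * F.chartToRatFun ℤ F.zeroCone g := by
      rw [hg, ← mul_assoc, ← F.character_add, add_neg_cancel, F.character_zero, one_mul]
    have hle : ∀ t, ‖torusPoint F.zeroCone.1 t g‖ ≤ 1 := fun t => by
      have h := (D.enorm_le_supNorm (torusPoint F.zeroCone.1 t) g (s := s)
        (fun m => by rw [torusPoint_single, norm_mFourier_apply]) hg).trans hnorm
      rwa [← ofReal_norm, ENNReal.ofReal_le_one] at h
    rcases eq_zero_or_single_of_norm_le_one g hle with rfl | ⟨m, rfl | rfl⟩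
    · right
      simpa using hs'
    · left
      rw [F.chartToRatFun_single, ← F.character_add] at hs'
      -- The torus alone puts no restriction on the exponent; that `s` is a global section forces it
      -- into the polytope.
      exact ⟨_, D.mem_polytope_of_character_mem hF ℤ (hs' ▸ hs), Or.inl hs'⟩
    · left
      rw [map_neg, F.chartToRatFun_single, mul_neg, ← F.character_add] at hs'
      refine ⟨_, D.mem_polytope_of_character_mem hF ℤ ?_, Or.inr hs'⟩
      rw [hs'] at hs
      simpa using hs
  · rintro (⟨m, hm, rfl | rfl⟩ | rfl)
    · exact ⟨D.character_mem_globalSections ℤ hm, D.supNorm_character_le hm⟩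
    · exact ⟨neg_mem (D.character_mem_globalSections ℤ hm),
        (D.supNorm_neg _).trans_le (D.supNorm_character_le hm)⟩
    · exact ⟨zero_mem _, D.supNorm_zero.trans_le zero_le_one⟩

/-- A nonzero section of norm less than one of some multiple would be a small section, hence `±χ^m`,
whose norm is at least one. -/
lemma not_isArithmeticallyBig (hF : F.IsComplete) : ¬ D.IsArithmeticallyBig := by
  rintro ⟨-, l, -, s, hs, hs0, hlt⟩
  have h : s ∈ (l • D).smallSections := ⟨hs, hlt.le⟩
  rw [smallSections_eq _ hF] at h
  rcases h with ⟨m, -, rfl | rfl⟩ | h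
  · exact hlt.not_ge (one_le_supNorm_character _ m)
  · rw [supNorm_neg] at hlt
    exact hlt.not_ge (one_le_supNorm_character _ m)
  · exact hs0 h

/-! ### Counting lattice points and the arithmetic volume -/

lemma nsmul_ψ (l : ℕ) (u : Fin d → ℝ) : (l • D).ψ u = l * D.ψ u := rfl

lemma polytope_nsmul {l : ℕ} (hl : 0 < l) : (l • D).polytope = (l : ℝ) • D.polytope := by
  have hl' : (0 : ℝ) < l := by exact_mod_cast hl
  ext v
  rw [Set.mem_smul_set_iff_inv_smul_mem₀ hl'.ne']
  refine forall_congr' fun u => ?_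
  rw [nsmul_ψ, smul_dotProduct, smul_eq_mul, le_inv_mul_iff₀ hl']

/-- The defining inequalities at `u = e_i` and `u = -e_i` already bound the `i`-th coordinate on
both sides. -/
lemma exists_polytope_bound : ∃ C : ℕ, 0 < C ∧ ∀ v ∈ D.polytope, ∀ i, |v i| ≤ C := by
  classical
  let B : Fin d → ℝ := fun i => |D.ψ (Pi.single i 1)| + |D.ψ (-Pi.single i 1)|
  have hB : ∀ i, 0 ≤ B i := fun i => by positivity
  obtain ⟨C, hC⟩ := exists_nat_ge (∑ i, B i)
  -- The extra one makes the bound positive, so that later `1 ≤ l * C` for `l ≥ 1`.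
  refine ⟨C + 1, C.succ_pos, fun v hv i => ?_⟩
  have h1 := hv (Pi.single i 1)
  have h2 := hv (-Pi.single i 1)
  rw [dotProduct_neg] at h2
  rw [dotProduct_single_one] at h1 h2
  have h3 : |v i| ≤ B i := abs_le.mpr
    ⟨by linarith [neg_abs_le (D.ψ (Pi.single i 1)), abs_nonneg (D.ψ (-Pi.single i 1))],
      by linarith [neg_abs_le (D.ψ (-Pi.single i 1)), abs_nonneg (D.ψ (Pi.single i 1))]⟩
  have h4 := Finset.single_le_sum (fun j _ => hB j) (Finset.mem_univ i)
  push_cast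
  linarith

lemma encard_smallSections_le (hF : F.IsComplete) :
    ∃ K : ℕ, 0 < K ∧ ∀ l : ℕ, 0 < l → (l • D).smallSections.encard ≤ (K * l ^ d : ℕ) := by
  classical
  obtain ⟨C, hC, hbound⟩ := D.exists_polytope_bound
  -- The box `[-lC, lC]^d` has `(2lC + 1)^d ≤ (3lC)^d` lattice points. The outer factor 3 accounts
  -- for the two signs and the zero section.
  refine ⟨3 * (3 * C) ^ d, by positivity, fun l hl => ?_⟩
  let P : Finset (Fin d → ℤ) :=
    Fintype.piFinset fun _ => Finset.Icc (-((l * C : ℕ) : ℤ)) ((l * C : ℕ) : ℤ)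
  let S : Finset (F.RatFun ℤ) :=
    P.image (F.character ℤ) ∪ P.image (fun m => -F.character ℤ m) ∪ {0}
  have hsub : (l • D).smallSections ⊆ S := by
    rw [smallSections_eq _ hF, D.polytope_nsmul hl]
    have hP : ∀ m : Fin d → ℤ, toReal m ∈ (l : ℝ) • D.polytope → m ∈ P := by
      rintro m ⟨v, hv, hvm⟩
      refine Fintype.mem_piFinset.mpr fun i => Finset.mem_Icc.mpr (abs_le.mp ?_)
      have h1 : (m i : ℝ) = l * v i := (congrFun hvm i).symm
      have h2 : |(m i : ℝ)| ≤ l * C := by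
        rw [h1, abs_mul, Nat.abs_cast]
        exact mul_le_mul_of_nonneg_left (hbound v hv i) (Nat.cast_nonneg l)
      exact_mod_cast h2
    rintro s (⟨m, hm, h⟩ | h)
    · have := hP m hm
      rcases h with rfl | rfl <;> simp only [S, Finset.coe_union, Finset.coe_image]
      · exact Or.inl (Or.inl ⟨m, this, rfl⟩)
      · exact Or.inl (Or.inr ⟨m, this, rfl⟩)
    · simp only [S, Finset.coe_union]
      exact Or.inr (by simpa using h)
  refine (Set.encard_le_encard hsub).trans ?_
  rw [Set.encard_coe_eq_coe_finsetCard]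
  have hcard : P.card = (2 * (l * C) + 1) ^ d := by
    simp only [P, Fintype.card_piFinset_const, Int.card_Icc]
    congr 1
    omega
  have h1 : S.card ≤ P.card + P.card + 1 := by
    refine (Finset.card_union_le _ _).trans (add_le_add ?_ (by simp))
    exact (Finset.card_union_le _ _).trans (add_le_add Finset.card_image_le Finset.card_image_le)
  have h2 : (2 * (l * C) + 1) ^ d ≤ (3 * C) ^ d * l ^ d := by
    rw [← mul_pow]
    refine Nat.pow_le_pow_left ?_ d
    have : 0 < l * C := Nat.mul_pos hl hC
    nlinarith
  have h3 : 1 ≤ (3 * C) ^ d * l ^ d := Nat.one_le_iff_ne_zero.mpr (by positivity)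
  exact_mod_cast (by rw [hcard] at h1; rw [mul_assoc]; omega : S.card ≤ 3 * (3 * C) ^ d * l ^ d)

/-- The zero section is always small; this keeps the logarithm of the cardinality nonnegative
instead of `⊥`. -/
lemma one_le_encard_smallSections (hF : F.IsComplete) : 1 ≤ D.smallSections.encard := by
  rw [Set.one_le_encard_iff_nonempty, smallSections_eq _ hF]
  exact ⟨0, Or.inr rfl⟩

lemma tendsto_log_div_pow (d K : ℕ) (hK : 0 < K) :
    Filter.Tendsto (fun l : ℕ => Real.log ((K * l ^ d : ℕ) : ℝ) /
      ((l : ℝ) ^ (d + 1) / ((d + 1).factorial : ℝ))) Filter.atTop (nhds 0) := by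
  have h1 : Filter.Tendsto (fun l : ℕ => Real.log (l : ℝ) / l) Filter.atTop (nhds 0) :=
    (Real.isLittleO_log_id_atTop.tendsto_div_nhds_zero).comp tendsto_natCast_atTop_atTop
  have h2 : Filter.Tendsto (fun l : ℕ => Real.log K / (l : ℝ)) Filter.atTop (nhds 0) :=
    tendsto_const_div_atTop_nhds_zero_nat _
  -- Majorant obtained from `log (K l^d) = log K + d log l` by weakening the denominator `l^(d+1)`
  -- to `l`.
  have h3 : Filter.Tendsto (fun l : ℕ => (Real.log K / (l : ℝ) + d * (Real.log (l : ℝ) / l)) *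
      ((d + 1).factorial : ℝ)) Filter.atTop (nhds 0) := by
    simpa using (h2.add (h1.const_mul (d : ℝ))).mul_const ((d + 1).factorial : ℝ)
  refine squeeze_zero' ?_ ?_ h3
  · filter_upwards with l
    have : 0 ≤ Real.log ((K * l ^ d : ℕ) : ℝ) := Real.log_natCast_nonneg _
    positivity
  · filter_upwards [Filter.eventually_gt_atTop 0] with l hl
    have hl' : (1 : ℝ) ≤ l := by exact_mod_cast hl
    have hlog : Real.log ((K * l ^ d : ℕ) : ℝ) = Real.log K + d * Real.log l := by
      push_cast
      rw [Real.log_mul (by positivity) (by positivity), Real.log_pow]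
    have hnn : 0 ≤ Real.log ((K * l ^ d : ℕ) : ℝ) := Real.log_natCast_nonneg _
    rw [div_div_eq_mul_div, ← mul_div_assoc, ← add_div, ← hlog, div_mul_eq_mul_div]
    refine div_le_div_of_nonneg_left (by positivity) (by positivity) ?_
    exact le_self_pow₀ hl' (Nat.succ_ne_zero d)

lemma arithmeticVolume_eq_zero (hF : F.IsComplete) : D.arithmeticVolume = 0 := by
  obtain ⟨K, hK, hle⟩ := D.encard_smallSections_le hF
  refine Filter.Tendsto.limsup_eq ?_
  refine tendsto_of_tendsto_of_tendsto_of_le_of_le' (tendsto_const_nhds (x := (0 : EReal)))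
    ((continuous_coe_real_ereal.tendsto 0).comp (tendsto_log_div_pow d K hK)) ?_ ?_
  · filter_upwards with l
    refine EReal.div_nonneg ?_ (EReal.coe_nonneg.mpr (by positivity))
    rw [ENNReal.zero_le_log_iff]
    exact_mod_cast one_le_encard_smallSections (l • D) hF
  · filter_upwards [Filter.eventually_gt_atTop 0] with l hl
    have hpos : 0 < K * l ^ d := by positivity
    have h2 : ((((l • D).smallSections.encard : ℕ∞)) : ENNReal) ≤
        ENNReal.ofReal ((K * l ^ d : ℕ) : ℝ) := by
      rw [ENNReal.ofReal_natCast]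
      exact_mod_cast ENat.toENNReal_le.mpr (hle l hl)
    have h3 := ENNReal.log_le_log h2
    -- Positivity of `K l^d` turns the extended logarithm into the real one, to which the limit
    -- computation applies.
    rw [ENNReal.log_ofReal_of_pos (by exact_mod_cast hpos)] at h3
    rw [Function.comp_apply, EReal.coe_div]
    exact EReal.div_le_div_right_of_nonneg (EReal.coe_nonneg.mpr (by positivity)) h3

end ToricDivisor

end Toric

theorem mainTheorem6 {d : ℕ} (F : Toric.Fan d) (hcomplete : F.IsComplete)
    (hsmooth : Smooth (F.structureMorphism ℤ)) (D : Toric.ToricDivisor F) :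
    (∀ l : ℕ, 0 < l →
      (l • D).smallSections =
        {s | ∃ m : Fin d → ℤ, Toric.toReal m ∈ (l : ℝ) • D.polytope ∧
          (s = F.character ℤ m ∨ s = -F.character ℤ m)} ∪ {0}) ∧
    (∀ l : ℕ, 0 < l → ¬ (l • D).IsArithmeticallyBig) ∧
    D.arithmeticVolume = 0 := by
  refine ⟨fun l hl => ?_, fun l _ => (l • D).not_isArithmeticallyBig hcomplete,
    D.arithmeticVolume_eq_zero hcomplete⟩
  rw [(l • D).smallSections_eq hcomplete, D.polytope_nsmul hl]
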